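/- Let $(W,S)$ be a Coxeter system of finite rank $N$, with $S=\{s_1,\dots,s_N\}$ and Coxeter matrix $(m_{ij})_{1\le i,j\le N}$, $m_{ij}\in\mathbb{N}\cup\{\infty\}$. Let $\Gamma_{W,S}=(S,Y)$ be its Coxeter graph: there is an edge $y_{ij}$ from $s_i$ to $s_j$ exactly when $i\ne j$ and $3\le m_{ij}\le\infty$, and $\bar y_{ij}=y_{ji}$. Let $\mathbb{Q}\Gamma_{W,S}$ be the path algebra: its $\mathbb{Q}$-basis is the set of all paths of $\Gamma_{W,S}$ (backtracking allowed, including the paths $[s_i]$ of length zero), with multiplication given by concatenation of paths, the product of two paths being $0$ if they cannot be concatenated. For $m\ge 3$ let $C_m(t)\in\mathbb{Z}[t]$ be the minimal polynomial of $4\cos^2(\pi/m)$, and let $K_m=\mathbb{Q}[t]/\langle C_m(t)\rangle\cong\mathbb{Q}(4\cos^2(\pi/m))$. Put $$\hat R_{W,S}=\mathbb{Q}\Gamma_{W,S}/I,$$ where $I$ is the two-sided ideal generated by the elements $C_{m_{ij}}(y_{ij}\bar y_{ij})$ for all ordered pairs $(i,j)$ with $3\le m_{ij}<\infty$; here $C_{m_{ij}}(y_{ij}\bar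 y_{ij})$ is evaluated in the ring $[s_i]\,\mathbb{Q}\Gamma_{W,S}\,[s_i]$, whose identity is $[s_i]$. Suppose that $T$ is a spanning tree of $\Gamma_{W,S}$ such that $3\le m_{ij}<\infty$ for every edge $y_{ij}$ of $T$. Then there is an isomorphism of unital rings (indeed of $\mathbb{Q}$-algebras) $$\hat R_{W,S}\cong M_N(Q),$$ where $Q$ is the free product over $\mathbb{Q}$ (the coproduct of unital $\mathbb{Q}$-algebras) of the following rings: - one copy of the field $K_{m_{ij}}$ for each pair $i<j$ with $3\le m_{ij}<\infty$; - one Laurent polynomial ring $\mathbb{Q}[z_{ij},z_{ij}^{-1}]$ for each pair $i<j$ with $3\le m_{ij}<\infty$ such that $y_{ij}$ is not an edge of $T$; - one free algebra $\mathbb{Q}\langle x_{ij},\bar x_{ij}\rangle$ in two non-commuting variables for each pair $i<j$ with $m_{ij}=\infty$ (such an edge is never in $T$). -/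

import Mathlib

/-- A path in the graph `G`: a sequence of consecutive edges from `src` to `tgt`; backtracking is
allowed and paths of length zero are the vertices. In a graph without loops and multiple edges this
is the same as a walk. -/
structure GraphPath {V : Type*} (G : SimpleGraph V) where
  src : V
  tgt : V
  walk : G.Walk src tgt

/-- The path algebra of `G` over `A`: the free `A`-module with basis the set of paths of `G`, with
multiplication given on paths by concatenation (zero if the paths cannot be concatenated). -/
def PathAlgebra (A : Type*) [CommRing A] {V : Type*} (G : SimpleGraph V) : Type _ :=
  GraphPath G →₀ A

namespace PathAlgebra

noncomputable section

instance (A : Type*) [CommRing A] {V : Type*} (G : SimpleGraph V) :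
    AddCommGroup (PathAlgebra A G) :=
  inferInstanceAs (AddCommGroup (GraphPath G →₀ A))

instance (A : Type*) [CommRing A] {V : Type*} (G : SimpleGraph V) :
    Module A (PathAlgebra A G) :=
  inferInstanceAs (Module A (GraphPath G →₀ A))

/-- The basis of the path algebra consisting of the paths. -/
def pathBasis (A : Type*) [CommRing A] {V : Type*} (G : SimpleGraph V) :
    Module.Basis (GraphPath G) A (PathAlgebra A G) :=
  Module.Basis.ofRepr (LinearEquiv.refl A (GraphPath G →₀ A))

/-- A path as an element of the path algebra. -/
def ofPath (A : Type*) [CommRing A] {V : Type*} {G : SimpleGraph V} (p : GraphPath G) :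
    PathAlgebra A G :=
  pathBasis A G p

/-- The product of two paths in the path algebra: their concatenation if the first one ends where
the second one starts, and zero otherwise. -/
def pathMul (A : Type*) [CommRing A] {V : Type*} [DecidableEq V] {G : SimpleGraph V}
    (p q : GraphPath G) : PathAlgebra A G :=
  if h : p.tgt = q.src then ofPath A ⟨p.src, q.tgt, p.walk.append (q.walk.copy h.symm rfl)⟩ else 0

/-- The bilinear extension of the product of paths. -/
def mulHom (A : Type*) [CommRing A] {V : Type*} [DecidableEq V] (G : SimpleGraph V) :
    PathAlgebra A G →ₗ[A] PathAlgebra A G →ₗ[A] PathAlgebra A G :=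
  (pathBasis A G).constr A fun p => (pathBasis A G).constr A fun q => pathMul A p q

lemma hom_ext {A : Type*} [CommRing A] {V : Type*} {G : SimpleGraph V}
    {N : Type*} [AddCommGroup N] [Module A N] {f g : PathAlgebra A G →ₗ[A] N}
    (h : ∀ p, f (ofPath A p) = g (ofPath A p)) : f = g :=
  (pathBasis A G).ext h

section

variable {A : Type*} [CommRing A] {V : Type*} [DecidableEq V] {G : SimpleGraph V}

lemma mulHom_ofPath (p q : GraphPath G) :
    mulHom A G (ofPath A p) (ofPath A q) = pathMul A p q := by
  simp only [mulHom, ofPath, Module.Basis.constr_basis]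

lemma pathMul_of_eq {u v w : V} (p : G.Walk u v) (q : G.Walk v w) :
    pathMul A (⟨u, v, p⟩ : GraphPath G) ⟨v, w, q⟩ = ofPath A ⟨u, w, p.append q⟩ := by
  simp [pathMul]

lemma pathMul_of_ne {p q : GraphPath G} (h : p.tgt ≠ q.src) : pathMul A p q = 0 := by
  simp [pathMul, h]

lemma mulHom_assoc (a b c : PathAlgebra A G) :
    mulHom A G (mulHom A G a b) c = mulHom A G a (mulHom A G b c) := by
  have key : ∀ p q r : GraphPath G,
      mulHom A G (mulHom A G (ofPath A p) (ofPath A q)) (ofPath A r) =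
        mulHom A G (ofPath A p) (mulHom A G (ofPath A q) (ofPath A r)) := by
    rintro ⟨p1, p2, p⟩ ⟨q1, q2, q⟩ ⟨r1, r2, r⟩
    simp only [mulHom_ofPath]
    by_cases h1 : p2 = q1
    · subst h1
      rw [pathMul_of_eq, mulHom_ofPath]
      by_cases h2 : q2 = r1
      · subst h2
        rw [pathMul_of_eq, pathMul_of_eq, mulHom_ofPath, pathMul_of_eq,
          SimpleGraph.Walk.append_assoc]
      · rw [pathMul_of_ne h2, pathMul_of_ne h2, map_zero]
    · rw [pathMul_of_ne h1, map_zero, LinearMap.zero_apply]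
      by_cases h2 : q2 = r1
      · subst h2
        rw [pathMul_of_eq, mulHom_ofPath, pathMul_of_ne h1]
      · rw [pathMul_of_ne h2, map_zero]
  have e1 : ∀ q r : GraphPath G,
      ((mulHom A G).flip (ofPath A r)).comp ((mulHom A G).flip (ofPath A q)) =
        (mulHom A G).flip (mulHom A G (ofPath A q) (ofPath A r)) :=
    fun q r => hom_ext fun p => key p q r
  have e2 : ∀ r : GraphPath G,
      ((mulHom A G).flip (ofPath A r)).comp (mulHom A G a) =
        (mulHom A G a).comp ((mulHom A G).flip (ofPath A r)) :=
    fun r => hom_ext fun q => LinearMap.congr_fun (e1 q r) a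
  have e3 : mulHom A G (mulHom A G a b) = (mulHom A G a).comp (mulHom A G b) :=
    hom_ext fun r => LinearMap.congr_fun (e2 r) b
  exact LinearMap.congr_fun e3 c

end

/-- The path of length zero at the vertex `v`, as an element of the path algebra. -/
def vertex (A : Type*) [CommRing A] {V : Type*} (G : SimpleGraph V) (v : V) : PathAlgebra A G :=
  ofPath A ⟨v, v, SimpleGraph.Walk.nil⟩

/-- The edge from `u` to `v`, as an element of the path algebra. -/
def edge (A : Type*) [CommRing A] {V : Type*} {G : SimpleGraph V} {u v : V} (h : G.Adj u v) :
    PathAlgebra A G :=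
  ofPath A ⟨u, v, h.toWalk⟩

section

variable {A : Type*} [CommRing A] {V : Type*} [Fintype V] [DecidableEq V] {G : SimpleGraph V}

lemma mulHom_one_left (a : PathAlgebra A G) : mulHom A G (∑ v, vertex A G v) a = a := by
  have : mulHom A G (∑ v, vertex A G v) = LinearMap.id := by
    refine hom_ext fun p => ?_
    obtain ⟨u, w, p⟩ := p
    rw [map_sum, LinearMap.sum_apply, Finset.sum_eq_single u]
    · rw [vertex, mulHom_ofPath, pathMul_of_eq]; rfl
    · intro v _ hv
      rw [vertex, mulHom_ofPath, pathMul_of_ne hv]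
    · simp
  rw [this]; rfl

lemma mulHom_one_right (a : PathAlgebra A G) : mulHom A G a (∑ v, vertex A G v) = a := by
  have : (mulHom A G).flip (∑ v, vertex A G v) = LinearMap.id := by
    refine hom_ext fun p => ?_
    obtain ⟨u, w, p⟩ := p
    rw [map_sum, LinearMap.sum_apply, Finset.sum_eq_single w]
    · rw [LinearMap.flip_apply, vertex, mulHom_ofPath, pathMul_of_eq,
        SimpleGraph.Walk.append_nil]; rfl
    · intro v _ hv
      rw [LinearMap.flip_apply, vertex, mulHom_ofPath, pathMul_of_ne (Ne.symm hv)]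
    · simp
  exact LinearMap.congr_fun this a

/-- On a finite vertex set the path algebra is a ring, with identity the sum of the vertices. -/
instance : Ring (PathAlgebra A G) where
  __ := (inferInstance : AddCommGroup (PathAlgebra A G))
  mul a b := mulHom A G a b
  one := ∑ v, vertex A G v
  mul_assoc := mulHom_assoc
  one_mul := mulHom_one_left
  mul_one := mulHom_one_right
  left_distrib a b c := map_add (mulHom A G a) b c
  right_distrib a b c := LinearMap.map_add₂ (mulHom A G) a b c
  zero_mul a := LinearMap.map_zero₂ (mulHom A G) a
  mul_zero a := map_zero (mulHom A G a)

instance : Algebra A (PathAlgebra A G) :=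
  Algebra.ofModule (fun r x y => LinearMap.map_smul₂ (mulHom A G) r x y)
    (fun r x y => map_smul (mulHom A G x) r y)

/-- For an edge `y` from `u` to `v` with reversed edge `ȳ`, the element `f(y ȳ)` of the subring
`[u] (AG) [u]`, whose identity is `[u]`: the variable is replaced by `y ȳ` and `1` by `[u]`. -/
def evalEdge (f : Polynomial A) {u v : V} (h : G.Adj u v) : PathAlgebra A G :=
  vertex A G u * Polynomial.aeval (edge A h * edge A h.symm) f

end

end

end PathAlgebra

namespace CoxeterMatrix

noncomputable section

/-- The Coxeter graph: `i ≠ j` are adjacent if `3 ≤ m i j ≤ ∞`. The value `0` of a Coxeter matrix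
encodes `∞`. -/
def coxeterGraph {B : Type*} (M : CoxeterMatrix B) : SimpleGraph B where
  Adj i j := i ≠ j ∧ (3 ≤ M i j ∨ M i j = 0)
  symm := ⟨fun i j h => ⟨h.1.symm, by rw [M.symmetric j i]; exact h.2⟩⟩
  loopless := ⟨fun _ h => h.1 rfl⟩

/-- The minimal polynomial `C_m` of `4 cos² (π / m)` in `ℤ[t]`. -/
def cosPoly (m : ℕ) : Polynomial ℤ :=
  minpoly ℤ (4 * Real.cos (Real.pi / m) ^ 2)

/-- The field `K_m = ℚ(4 cos² (π / m))`. -/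
abbrev CosField (m : ℕ) : Type :=
  IntermediateField.adjoin ℚ {4 * Real.cos (Real.pi / m) ^ 2}

/-- The two-sided ideal of the rational path algebra of the Coxeter graph that is generated by the
elements `C_{m i j}(y ȳ)`, for all (oriented) edges `y` from `i` to `j` with `3 ≤ m i j < ∞`. -/
def relationIdeal {B : Type*} [Fintype B] [DecidableEq B] (M : CoxeterMatrix B) :
    TwoSidedIdeal (PathAlgebra ℚ M.coxeterGraph) :=
  TwoSidedIdeal.span {x | ∃ (i j : B) (h : M.coxeterGraph.Adj i j), 3 ≤ M i j ∧
    x = PathAlgebra.evalEdge ((cosPoly (M i j)).map (Int.castRingHom ℚ)) h}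

/-- The algebra `R̂_{W,S}`: the path algebra of the Coxeter graph over `ℚ` modulo the ideal
`relationIdeal`. -/
abbrev PathQuotient {B : Type*} [Fintype B] [DecidableEq B] (M : CoxeterMatrix B) : Type _ :=
  (relationIdeal M).ringCon.Quotient

/-- The index set of the free product: one index for each geometric edge `{i, j}` with finite
label, one for each such edge outside `T`, and one for each edge with label `∞` (outside `T`). -/
inductive FactorIndex {N : ℕ} (M : CoxeterMatrix (Fin N)) (T : SimpleGraph (Fin N)) : Type
  | field (i j : Fin N) (hij : i < j) (hm : 3 ≤ M i j)
  | laurent (i j : Fin N) (hij : i < j) (hm : 3 ≤ M i j) (hT : ¬ T.Adj i j)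
  | free (i j : Fin N) (hij : i < j) (hm : M i j = 0) (hT : ¬ T.Adj i j)
  deriving DecidableEq

/-- The factors of the free product: the field `K_{m i j}`, the Laurent polynomial ring over `ℚ`,
or the free algebra over `ℚ` in two non-commuting variables. -/
def Factor {N : ℕ} (M : CoxeterMatrix (Fin N)) (T : SimpleGraph (Fin N)) :
    FactorIndex M T → Type
  | .field i j _ _ => CosField (M i j)
  | .laurent _ _ _ _ _ => LaurentPolynomial ℚ
  | .free _ _ _ _ _ => FreeAlgebra ℚ (Fin 2)

instance {N : ℕ} (M : CoxeterMatrix (Fin N)) (T : SimpleGraph (Fin N)) :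
    ∀ x : FactorIndex M T, Ring (Factor M T x)
  | .field i j _ _ => inferInstanceAs (Ring (CosField (M i j)))
  | .laurent _ _ _ _ _ => inferInstanceAs (Ring (LaurentPolynomial ℚ))
  | .free _ _ _ _ _ => inferInstanceAs (Ring (FreeAlgebra ℚ (Fin 2)))

instance {N : ℕ} (M : CoxeterMatrix (Fin N)) (T : SimpleGraph (Fin N)) :
    ∀ x : FactorIndex M T, Algebra ℚ (Factor M T x)
  | .field i j _ _ => inferInstanceAs (Algebra ℚ (CosField (M i j)))
  | .laurent _ _ _ _ _ => inferInstanceAs (Algebra ℚ (LaurentPolynomial ℚ))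
  | .free _ _ _ _ _ => inferInstanceAs (Algebra ℚ (FreeAlgebra ℚ (Fin 2)))

/-- The free product (coproduct of `ℚ`-algebras) of all the factors. -/
abbrev FactorProduct {N : ℕ} (M : CoxeterMatrix (Fin N)) (T : SimpleGraph (Fin N)) : Type :=
  LinearAlgebra.FreeProduct ℚ (Factor M T)

end

end CoxeterMatrix

/-!
Write `R` for the quotient of the path algebra by the relations and `Q` for the free product.

For `m ≥ 3` the number `4 cos² (π / m)` is not zero, so `C_m` has a nonzero constant coefficient, and
the relations `C_m(y ȳ) = 0` and `C_m(ȳ y) = 0` make every edge `y` with a finite label invertible in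
`R`, as an element between two corners (`exists_inverse_in_corner`). Products of edges of `T` and
their inverses along walks in `T` depend only on the end points of the walk
(`PathAlgebra.IsRep.walkProd_eq`), and so they form a complete system of matrix units `F i j` in `R`
with `F i i = [i]`. Hence `R` is a matrix algebra over the commutant of `F`, and the commutant is
generated by the elements `∑ k, F k i * y i j * F j k` (`IsMatrixUnits.spread`), one for each
oriented edge.

On the other side, `Q` has a presentation with one generator for each oriented edge
(`CoxeterMatrix.label`): for `i < j` and `m i j < ∞`, `a i j` is `1` on `T` and a Laurent variable off
`T`, and `a i j * a j i` generates `K_{m i j}`; for `m i j = ∞`, `a i j` and `a j i` are free variables.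
The lemmas `exists_hom_label_eq` and `hom_ext_label` say that homomorphisms out of `Q` are
families of elements that satisfy the relations of the edges, are invertible for `i < j`, and are `1`
on `T` for `i < j`. The spread edges are such a family if the edges `(i, j)` of `T` with `i < j` are
themselves taken as matrix units.

This gives a homomorphism from `Mₙ(Q)` to `R` by `a i j E i j ↦ y i j`, and the universal property of
the path algebra gives its inverse `y i j ↦ a i j E i j`. No corner ring has to be computed: both
compositions are checked on generators.
-/

/-! ### Homomorphisms out of a path algebra -/

namespace PathAlgebra

section Representation

variable {V : Type*} {G : SimpleGraph V} {B : Type*} [Semiring B] {e : V → B} {y : V → V → B}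

/-- The product of the elements `y u v` along the edges `(u, v)` of a walk, closed off by the
element `e` attached to the last vertex. The walk of length zero at `u` gives `e u`. -/
def walkProd (e : V → B) (y : V → V → B) : ∀ {u v : V}, G.Walk u v → B
  | u, _, .nil => e u
  | u, _, .cons (v := v) _ p => y u v * walkProd e y p

@[simp] lemma walkProd_nil (u : V) : walkProd e y (.nil : G.Walk u u) = e u := rfl

@[simp] lemma walkProd_cons {u v w : V} (h : G.Adj u v) (p : G.Walk v w) :
    walkProd e y (.cons h p) = y u v * walkProd e y p := rfl

lemma map_walkProd {B' : Type*} [Semiring B'] {F : Type*} [FunLike F B B'] [MulHomClass F B B']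
    (f : F) {u v : V} (p : G.Walk u v) :
    f (walkProd e y p) = walkProd (fun i => f (e i)) (fun i j => f (y i j)) p := by
  induction p with
  | nil => rfl
  | cons h p ih => simp [ih]

variable (G e y) in
/-- The relations between the images `e u` of the vertices and `y u v` of the edges under a unital
homomorphism from the path algebra of `G`: the `e u` are a complete system of orthogonal
idempotents, and `y u v ∈ e u B e v`. The values of `y` off the edges of `G` are irrelevant. -/
structure IsRep [Fintype V] [DecidableEq V] : Prop where
  mul : ∀ u v, e u * e v = if u = v then e u else 0
  sum : ∑ u, e u = 1
  left : ∀ {u v}, G.Adj u v → e u * y u v = y u v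
  right : ∀ {u v}, G.Adj u v → y u v * e v = y u v

namespace IsRep

variable [Fintype V] [DecidableEq V] (H : IsRep G e y)
include H

lemma mul_self (u : V) : e u * e u = e u := by simp [H.mul]

lemma map {B' : Type*} [Semiring B'] {F : Type*} [FunLike F B B'] [RingHomClass F B B'] (f : F) :
    IsRep G (fun i => f (e i)) (fun i j => f (y i j)) where
  mul u v := by rw [← map_mul, H.mul]; split_ifs <;> simp
  sum := by rw [← map_sum, H.sum, map_one]
  left h := by rw [← map_mul, H.left h]
  right h := by rw [← map_mul, H.right h]

lemma mul_walkProd {u v : V} (p : G.Walk u v) : e u * walkProd e y p = walkProd e y p := by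
  cases p with
  | nil => exact H.mul_self u
  | cons h p => rw [walkProd_cons, ← mul_assoc, H.left h]

lemma walkProd_mul {u v : V} (p : G.Walk u v) : walkProd e y p * e v = walkProd e y p := by
  induction p with
  | nil => exact H.mul_self _
  | cons h p ih => rw [walkProd_cons, mul_assoc, ih]

lemma walkProd_append {u v w : V} (p : G.Walk u v) (q : G.Walk v w) :
    walkProd e y (p.append q) = walkProd e y p * walkProd e y q := by
  induction p with
  | nil => exact (H.mul_walkProd q).symm
  | cons h p ih => rw [SimpleGraph.Walk.cons_append, walkProd_cons, walkProd_cons, ih, mul_assoc]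

end IsRep

end Representation

open Classical in
/-- The edge from `u` to `v` as an element of the path algebra, and `0` if there is none. -/
noncomputable def edgeOrZero (A : Type*) [CommRing A] {V : Type*} (G : SimpleGraph V) (u v : V) :
    PathAlgebra A G :=
  if h : G.Adj u v then edge A h else 0

lemma edgeOrZero_of_adj {A : Type*} [CommRing A] {V : Type*} {G : SimpleGraph V}
    {u v : V} (h : G.Adj u v) :
    edgeOrZero A G u v = edge A h :=
  dif_pos h

section Lift

variable {A : Type*} [CommRing A] {V : Type*} [Fintype V] [DecidableEq V] {G : SimpleGraph V}
  {B : Type*} [Semiring B] [Algebra A B] {e : V → B} {y : V → V → B}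

lemma ofPath_mul_ofPath (p q : GraphPath G) : ofPath A p * ofPath A q = pathMul A p q :=
  mulHom_ofPath p q

lemma one_eq_sum_vertex : (1 : PathAlgebra A G) = ∑ v, vertex A G v := rfl

noncomputable section

/-- The homomorphism from the path algebra that sends the vertex `u` to `e u` and the edge from `u`
to `v` to `y u v`. -/
def lift (H : IsRep G e y) : PathAlgebra A G →ₐ[A] B :=
  AlgHom.ofLinearMap ((pathBasis A G).constr A fun p => walkProd e y p.walk)
    (by
      rw [one_eq_sum_vertex, map_sum, ← H.sum]
      exact Finset.sum_congr rfl fun v _ => Module.Basis.constr_basis _ _ _ _)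
    (by
      set f := (pathBasis A G).constr A fun p => walkProd e y p.walk with hf
      have hfp (p : GraphPath G) : f (ofPath A p) = walkProd e y p.walk :=
        Module.Basis.constr_basis _ _ _ _
      have key (p q : GraphPath G) :
          f (ofPath A p * ofPath A q) = f (ofPath A p) * f (ofPath A q) := by
        obtain ⟨p1, p2, p⟩ := p
        obtain ⟨q1, q2, q⟩ := q
        rw [ofPath_mul_ofPath]
        by_cases h : p2 = q1
        · subst h
          rw [pathMul_of_eq, hfp, hfp, hfp, H.walkProd_append]
        · rw [pathMul_of_ne h, map_zero, hfp, hfp, ← H.walkProd_mul p, ← H.mul_walkProd q,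
            mul_assoc, ← mul_assoc (e p2), H.mul, if_neg h, zero_mul, mul_zero]
      intro a b
      have h1 (q : GraphPath G) : f ∘ₗ LinearMap.mulRight A (ofPath A q) =
          LinearMap.mulRight A (f (ofPath A q)) ∘ₗ f := (pathBasis A G).ext fun p => key p q
      have h2 : f ∘ₗ LinearMap.mulLeft A a = LinearMap.mulLeft A (f a) ∘ₗ f :=
        (pathBasis A G).ext fun q => LinearMap.congr_fun (h1 q) a
      exact LinearMap.congr_fun h2 b)

@[simp] lemma lift_ofPath (H : IsRep G e y) (p : GraphPath G) :
    lift H (ofPath A p) = walkProd e y p.walk :=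
  (pathBasis A G).constr_basis A (fun p => walkProd e y p.walk) p

@[simp] lemma lift_vertex (H : IsRep G e y) (u : V) : lift H (vertex A G u) = e u :=
  lift_ofPath H _

@[simp] lemma lift_edge (H : IsRep G e y) {u v : V} (h : G.Adj u v) :
    lift H (edge A h) = y u v :=
  (lift_ofPath H _).trans (H.right h)

end

lemma ofPath_cons {u v w : V} (h : G.Adj u v) (p : G.Walk v w) :
    ofPath A ⟨u, w, .cons h p⟩ = edge A h * ofPath A ⟨v, w, p⟩ := by
  rw [edge, ofPath_mul_ofPath, pathMul_of_eq]
  rfl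

/-- A homomorphism from the path algebra is determined by the images of the vertices and edges. -/
lemma algHom_ext {f g : PathAlgebra A G →ₐ[A] B}
    (hv : ∀ u, f (vertex A G u) = g (vertex A G u))
    (he : ∀ {u v} (h : G.Adj u v), f (edge A h) = g (edge A h)) : f = g := by
  refine AlgHom.toLinearMap_injective ((pathBasis A G).ext ?_)
  rintro ⟨u, w, p⟩
  change f (ofPath A _) = g (ofPath A _)
  induction p with
  | nil => exact hv _
  | cons h p ih => rw [ofPath_cons, map_mul, map_mul, he, ih]

variable (A G) in
lemma isRep_vertex_edge : IsRep G (vertex A G) (edgeOrZero A G) where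
  mul u v := by
    split_ifs with h
    · subst h
      exact (ofPath_mul_ofPath _ _).trans (pathMul_of_eq _ _)
    · exact (ofPath_mul_ofPath _ _).trans (pathMul_of_ne h)
  sum := rfl
  left h := by
    rw [edgeOrZero_of_adj h]
    exact (ofPath_mul_ofPath _ _).trans (pathMul_of_eq _ _)
  right h := by
    rw [edgeOrZero_of_adj h]
    exact (ofPath_mul_ofPath _ _).trans (pathMul_of_eq _ _)

end Lift

end PathAlgebra

/-! ### Matrix units -/

section MatrixUnits

variable {n : Type*} {B : Type*} [Semiring B] {F : n → n → B}

namespace IsMatrixUnits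

/-- The subalgebra of all elements that commute with the matrix units. -/
abbrev commutant (A : Type*) [CommSemiring A] [Algebra A B] (F : n → n → B) : Subalgebra A B :=
  Subalgebra.centralizer A (Set.range fun x : n × n => F x.1 x.2)

variable {A : Type*} [CommSemiring A] [Algebra A B] in
lemma commutant_comm (x : commutant A F) (i j : n) : F i j * (x : B) = x * F i j :=
  x.2 _ ⟨(i, j), rfl⟩

end IsMatrixUnits

variable [Fintype n] [DecidableEq n]

/-- A complete system of matrix units in a ring `B`, indexed by `n`. -/
structure IsMatrixUnits (F : n → n → B) : Prop where
  mul : ∀ i j k l, F i j * F k l = if j = k then F i l else 0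
  sum : ∑ i, F i i = 1

namespace IsMatrixUnits

lemma mul_same (H : IsMatrixUnits F) (i j k : n) : F i j * F j k = F i k := by simp [H.mul]

lemma mul_ne (H : IsMatrixUnits F) {j k : n} (h : j ≠ k) (i l : n) : F i j * F k l = 0 := by
  simp [H.mul, h]

/-- Only one summand survives on multiplying by a matrix unit from the left. -/
lemma mul_spread (H : IsMatrixUnits F) (i j k l : n) (a : B) :
    F k l * ∑ x, F x i * a * F j x = F k i * a * F j l := by
  rw [Finset.mul_sum, Finset.sum_eq_single l]
  · rw [← mul_assoc, ← mul_assoc, H.mul_same]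
  · intro x _ hx
    rw [← mul_assoc, ← mul_assoc, H.mul_ne hx.symm, zero_mul, zero_mul]
  · simp

lemma spread_mul (H : IsMatrixUnits F) (i j k l : n) (a : B) :
    (∑ x, F x i * a * F j x) * F k l = F k i * a * F j l := by
  rw [Finset.sum_mul, Finset.sum_eq_single k]
  · rw [mul_assoc, H.mul_same]
  · intro x _ hx
    rw [mul_assoc, H.mul_ne hx, mul_zero]
  · simp

variable (A : Type*) [CommSemiring A] [Algebra A B]

/-- The element of the commutant of a system `F` of matrix units that is obtained from `a` by
moving it from the place `(i, j)` to all diagonal places. -/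
def spread (H : IsMatrixUnits F) (i j : n) (a : B) : commutant A F :=
  ⟨∑ k, F k i * a * F j k, by
    rintro _ ⟨⟨k, l⟩, rfl⟩
    rw [H.mul_spread, H.spread_mul]⟩

variable {A} (H : IsMatrixUnits F)

lemma coe_spread (i j : n) (a : B) :
    (H.spread A i j a : B) = ∑ k, F k i * a * F j k := rfl

/-- Spreading is multiplicative on composable corners. -/
lemma spread_mul_spread (i j k : n) {a b : B} (ha : a * F j j = a) :
    H.spread A i j a * H.spread A j k b = H.spread A i k (a * b) := by
  ext
  rw [Subalgebra.coe_mul, coe_spread, Finset.sum_mul, coe_spread]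
  refine Finset.sum_congr rfl fun x _ => ?_
  rw [mul_assoc, H.mul_spread]
  nth_rw 2 [← ha]
  simp only [mul_assoc]

lemma spread_self (i j : n) : H.spread A i j (F i j) = 1 := by
  ext
  rw [coe_spread, Subalgebra.coe_one, ← H.sum]
  exact Finset.sum_congr rfl fun x _ => by rw [H.mul_same, H.mul_same]

/-- Multiplying by the matrix unit at `(i, j)` recovers an element of the corner `(i, j)`. -/
lemma coe_spread_mul (i j : n) {a : B} (ha : F i i * a = a) (ha' : a * F j j = a) :
    (H.spread A i j a : B) * F i j = a := by
  rw [coe_spread, H.spread_mul, ha, ha']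

include H in
/-- An element of the commutant is determined by its part in one diagonal corner. -/
lemma commutant_eq_zero {x : commutant A F} {i : n} (hx : (x : B) * F i i = 0) : x = 0 := by
  ext
  rw [Subalgebra.coe_zero, ← mul_one (x : B), ← H.sum, Finset.mul_sum]
  refine Finset.sum_eq_zero fun k _ => ?_
  rw [← H.mul_same k i k, ← mul_assoc, ← commutant_comm, ← H.mul_same i i k, mul_assoc,
    ← mul_assoc (x : B), hx, zero_mul, mul_zero]

/-- The homomorphism from a matrix algebra `Mₙ(Q)` that is given by a system of matrix units and a
homomorphism from `Q` to its commutant. -/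
def matrixLift {Q : Type*} [Semiring Q] [Algebra A Q] (H : IsMatrixUnits F)
    (g : Q →ₐ[A] commutant A F) : Matrix n n Q →ₐ[A] B :=
  AlgHom.ofLinearMap
    { toFun := fun X => ∑ i, ∑ j, (g (X i j) : B) * F i j
      map_add' := fun X Y => by simp [add_mul, Finset.sum_add_distrib]
      map_smul' := fun c X => by simp [Finset.smul_sum] }
    (by
      change ∑ i, ∑ j, _ = _
      rw [← H.sum]
      refine Finset.sum_congr rfl fun i _ => ?_
      rw [Finset.sum_eq_single i] <;> simp +contextual [eq_comm])
    (by
      intro X Y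
      change ∑ i, ∑ j, (g ((X * Y) i j) : B) * F i j =
        (∑ i, ∑ j, (g (X i j) : B) * F i j) * ∑ i, ∑ j, (g (Y i j) : B) * F i j
      rw [Finset.sum_mul]
      refine Finset.sum_congr rfl fun i _ => ?_
      have h (j k l : n) : (g (X i j) : B) * F i j * ((g (Y k l) : B) * F k l) =
          if j = k then (g (X i j) : B) * g (Y k l) * F i l else 0 := by
        rw [mul_assoc, ← mul_assoc (F i j), commutant_comm, mul_assoc, H.mul]
        split_ifs <;> simp [mul_assoc]
      simp only [Finset.sum_mul, Finset.mul_sum, h, Matrix.mul_apply, map_sum,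
        map_mul, AddSubmonoidClass.coe_finsetSum, Subalgebra.coe_mul]
      rw [Finset.sum_comm]
      exact Finset.sum_congr rfl fun j _ => Finset.sum_congr rfl fun l _ => by simp)

lemma matrixLift_apply {Q : Type*} [Semiring Q] [Algebra A Q]
    (g : Q →ₐ[A] commutant A F) (X : Matrix n n Q) :
    H.matrixLift g X = ∑ i, ∑ j, (g (X i j) : B) * F i j := rfl

lemma matrixLift_single {Q : Type*} [Semiring Q] [Algebra A Q]
    (g : Q →ₐ[A] commutant A F) (i j : n) (q : Q) :
    H.matrixLift g (Matrix.single i j q) = g q * F i j := by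
  rw [matrixLift_apply, Finset.sum_eq_single i, Finset.sum_eq_single j]
  · simp
  · intro k _ hk
    simp [hk.symm]
  · simp
  · intro k _ hk
    simp [hk.symm]
  · simp

end IsMatrixUnits

end MatrixUnits

/-! ### Matrix units from a tree of invertible edges -/

namespace PathAlgebra.IsRep

variable {V : Type*} [Fintype V] [DecidableEq V] {T : SimpleGraph V} {B : Type*} [Semiring B]
  {e : V → B} {y : V → V → B}

/-- If reversed edges of a forest are mapped to inverse elements, then the product along a walk
depends only on its end points: backtracking cancels, and there is only one path. -/
lemma walkProd_eq (H : IsRep T e y) (hT : T.IsAcyclic)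
    (hy : ∀ {u v}, T.Adj u v → y u v * y v u = e u) {u v : V} (p q : T.Walk u v) :
    walkProd e y p = walkProd e y q := by
  have key : ∀ {u v : V} (p q : T.Walk u v), q.IsPath → walkProd e y p = walkProd e y q := by
    intro u v p
    induction p with
    | nil =>
      intro q hq
      rw [(SimpleGraph.Walk.isPath_iff_nil.1 hq).eq_nil]
    | @cons u v w h p ih =>
      intro q hq
      have hunique {a b : V} {q q' : T.Walk a b} (hq : q.IsPath) (hq' : q'.IsPath) : q = q' :=
        congrArg Subtype.val ((hT.subsingleton_path a b).elim ⟨q, hq⟩ ⟨q', hq'⟩)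
      rw [walkProd_cons, ih p.bypass p.bypass_isPath]
      have hp := p.bypass_isPath
      generalize p.bypass = p' at hp
      by_cases hu : u ∈ p'.support
      · cases p' with
        | nil => exact absurd (by simpa using hu) h.ne
        | @cons _ x _ h' r =>
          have hux : u = x := by
            simpa using hT.eq_snd_of_adj_start hp h.symm hu
          subst hux
          rw [walkProd_cons, ← mul_assoc, hy h, H.mul_walkProd, hunique hp.of_cons hq]
      · rw [hunique hq (SimpleGraph.Walk.IsPath.cons (h := h) hp hu), walkProd_cons]
  obtain ⟨r, hr⟩ : ∃ r : T.Walk u v, r.IsPath := ⟨p.bypass, p.bypass_isPath⟩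
  rw [key p r hr, key q r hr]

/-- A spanning tree whose reversed edges are mapped to inverse elements gives a system of matrix
units. -/
lemma isMatrixUnits (H : IsRep T e y) (hT : T.IsTree)
    (hy : ∀ {u v}, T.Adj u v → y u v * y v u = e u) (w : ∀ u v, T.Walk u v) :
    IsMatrixUnits fun u v => walkProd e y (w u v) where
  mul i j k l := by
    split_ifs with h
    · subst h
      rw [← H.walkProd_append]
      exact H.walkProd_eq hT.isAcyclic hy _ _
    · rw [← H.walkProd_mul (w i j), ← H.mul_walkProd (w k l), mul_assoc, ← mul_assoc (e j), H.mul,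
        if_neg h, zero_mul, mul_zero]
  sum := by
    rw [← H.sum]
    exact Finset.sum_congr rfl fun i _ => H.walkProd_eq hT.isAcyclic hy (w i i) .nil

end PathAlgebra.IsRep

/-! ### Inverting an edge -/

section InverseInCorner

open Polynomial

variable {K : Type*} [Field K] {B : Type*} [Ring B] [Algebra K B]

lemma SemiconjBy.aeval_right {a b c : B} (h : SemiconjBy a b c) (p : K[X]) :
    SemiconjBy a (aeval b p) (aeval c p) := by
  induction p using Polynomial.induction_on' with
  | add p q hp hq => simpa only [map_add] using hp.add_right hq
  | monomial n r =>
    rw [aeval_monomial, aeval_monomial]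
    exact SemiconjBy.mul_right (Algebra.commutes r a).symm (h.pow_right n)

lemma mul_aeval_mul_comm (p : K[X]) (a b : B) :
    a * aeval (b * a) p = aeval (a * b) p * a :=
  SemiconjBy.aeval_right (show SemiconjBy a (b * a) (a * b) from (mul_assoc _ _ _).symm) p

/-- Let `e y = y` and `y' ∈ f B e`. If `y y'` in `e B e` and `y' y` in
`f B f` are roots of a polynomial with nonzero constant coefficient, then `y` has a two-sided
inverse in `f B e`. -/
lemma exists_inverse_in_corner {p : K[X]} (hp : p.coeff 0 ≠ 0) {e f y y' : B}
    (h1 : e * y = y) (h3 : f * y' = y') (h4 : y' * e = y')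
    (h5 : e * aeval (y * y') p = 0) (h6 : f * aeval (y' * y) p = 0) :
    ∃ z, f * z = z ∧ z * e = z ∧ y * z = e ∧ z * y = f := by
  -- With `p = d X + c`, the inverse of `y` is `-c⁻¹ y' d(y y')`.
  set c := p.coeff 0 with hc
  have hdec (a : B) : aeval a p = a * aeval a p.divX + algebraMap K B c := by
    conv_lhs => rw [← divX_mul_X_add p]
    rw [map_add, map_mul, aeval_X, aeval_C]
    congr 1
    exact (SemiconjBy.aeval_right (Commute.refl a) p.divX).eq.symm
  have h7 : y * y' * aeval (y * y') p.divX = -(c • e) := by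
    rw [hdec, mul_add, ← mul_assoc, ← mul_assoc, h1, ← Algebra.commutes, ← Algebra.smul_def] at h5
    exact eq_neg_of_add_eq_zero_left h5
  have h8 : y' * y * aeval (y' * y) p.divX = -(c • f) := by
    rw [hdec, mul_add, ← mul_assoc, ← mul_assoc, h3, ← Algebra.commutes, ← Algebra.smul_def] at h6
    exact eq_neg_of_add_eq_zero_left h6
  have h9 : Commute (aeval (y * y') p.divX) e := by
    have : Commute e (y * y') := by
      rw [commute_iff_eq, ← mul_assoc, h1, mul_assoc, h4]
    exact Commute.symm (SemiconjBy.aeval_right this _)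
  refine ⟨-(c⁻¹ • (y' * aeval (y * y') p.divX)), ?_, ?_, ?_, ?_⟩
  · rw [mul_neg, mul_smul_comm, ← mul_assoc, h3]
  · rw [neg_mul, smul_mul_assoc, mul_assoc, h9.eq, ← mul_assoc, h4]
  · rw [mul_neg, mul_smul_comm, ← mul_assoc, h7, smul_neg, neg_neg, smul_smul, inv_mul_cancel₀ hp,
      one_smul]
  · rw [neg_mul, smul_mul_assoc, mul_assoc, ← mul_aeval_mul_comm, ← mul_assoc, h8, smul_neg,
      neg_neg, smul_smul, inv_mul_cancel₀ hp, one_smul]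

end InverseInCorner

/-! ### The polynomials `C_m` -/

namespace CoxeterMatrix

open Polynomial

lemma isIntegral_four_mul_cos_sq (m : ℕ) : IsIntegral ℤ (4 * Real.cos (Real.pi / m) ^ 2) := by
  have h := (Real.isIntegral_two_mul_cos_rat_mul_pi (1 / m)).pow 2
  convert h using 1
  push_cast
  rw [one_div_mul_eq_div]
  ring

lemma map_cosPoly (m : ℕ) : (cosPoly m).map (Int.castRingHom ℚ) =
    minpoly ℚ (4 * Real.cos (Real.pi / m) ^ 2) :=
  (minpoly.isIntegrallyClosed_eq_field_fractions' ℚ (isIntegral_four_mul_cos_sq m)).symm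

lemma coeff_zero_map_cosPoly_ne_zero {m : ℕ} (hm : 3 ≤ m) :
    ((cosPoly m).map (Int.castRingHom ℚ)).coeff 0 ≠ 0 := by
  rw [map_cosPoly]
  refine minpoly.coeff_zero_ne_zero (isIntegral_four_mul_cos_sq m).tower_top ?_
  have h3 : (3 : ℝ) ≤ m := by exact_mod_cast hm
  have : 0 < Real.cos (Real.pi / m) := Real.cos_pos_of_mem_Ioo
    ⟨(neg_lt_zero.2 (by positivity)).trans (by positivity),
      div_lt_div_of_pos_left Real.pi_pos two_pos (by linarith)⟩
  positivity

/-- The generator `4 cos² (π / m)` of the field `K_m`. -/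
noncomputable def cosGen (m : ℕ) : CosField m :=
  IntermediateField.AdjoinSimple.gen ℚ (4 * Real.cos (Real.pi / m) ^ 2)

lemma aeval_cosGen (m : ℕ) : aeval (cosGen m) ((cosPoly m).map (Int.castRingHom ℚ)) = 0 := by
  rw [map_cosPoly, ← IntermediateField.minpoly_gen]
  exact minpoly.aeval _ _

section

variable {B : Type*} [Ring B] [Algebra ℚ B]

/-- Homomorphisms from `K_m` to a not necessarily commutative algebra correspond to the roots of
`C_m`. -/
lemma exists_cosField_hom {m : ℕ} {b : B}
    (hb : aeval b ((cosPoly m).map (Int.castRingHom ℚ)) = 0) :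
    ∃ f : CosField m →ₐ[ℚ] B, f (cosGen m) = b := by
  have hi : IsIntegral ℚ (4 * Real.cos (Real.pi / m) ^ 2) :=
    (isIntegral_four_mul_cos_sq m).tower_top
  have hg := IntermediateField.adjoin.powerBasis_gen hi
  have hb' : aeval b (minpoly ℚ (IntermediateField.adjoin.powerBasis hi).gen) = 0 := by
    rw [hg, ← hb, map_cosPoly]
    congr 1
    exact IntermediateField.minpoly_gen ℚ _
  refine ⟨(IntermediateField.adjoin.powerBasis hi).lift b hb', ?_⟩
  have := (IntermediateField.adjoin.powerBasis hi).lift_gen b hb'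
  rwa [hg] at this

lemma cosField_hom_ext {m : ℕ} {f g : CosField m →ₐ[ℚ] B} (h : f (cosGen m) = g (cosGen m)) :
    f = g := by
  have hi : IsIntegral ℚ (4 * Real.cos (Real.pi / m) ^ 2) :=
    (isIntegral_four_mul_cos_sq m).tower_top
  refine (IntermediateField.adjoin.powerBasis hi).algHom_ext ?_
  rw [IntermediateField.adjoin.powerBasis_gen hi]
  exact h

end

end CoxeterMatrix

/-! ### Homomorphisms from Laurent polynomials to noncommutative algebras -/

namespace LaurentPolynomial

variable {A : Type*} [CommSemiring A]

/-- The variable of the Laurent polynomial ring, as a unit. -/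
noncomputable def unitT (A : Type*) [CommSemiring A] : (LaurentPolynomial A)ˣ where
  val := T 1
  inv := T (-1)
  val_inv := by rw [← T_add, add_neg_cancel, T_zero]
  inv_val := by rw [← T_add, neg_add_cancel, T_zero]

variable {B : Type*} [Semiring B] [Algebra A B]

lemma exists_hom_of_unit (u : Bˣ) : ∃ f : LaurentPolynomial A →ₐ[A] B, f (T 1) = u := by
  refine ⟨AddMonoidAlgebra.lift A B ℤ ((Units.coeHom B).comp (zpowersHom Bˣ u)), ?_⟩
  rw [T, AddMonoidAlgebra.lift_single]
  simp

lemma algHom_ext_T {f g : LaurentPolynomial A →ₐ[A] B} (h : f (T 1) = g (T 1)) : f = g := by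
  refine (AddMonoidAlgebra.lift A B ℤ).symm.injective (MonoidHom.ext_mint ?_)
  exact h

end LaurentPolynomial

/-! ### The free product as a universal algebra of edge labels -/

namespace CoxeterMatrix

open Polynomial

noncomputable section

variable {N : ℕ} (M : CoxeterMatrix (Fin N)) (T : SimpleGraph (Fin N))

/-- The canonical embedding of a factor into the free product. -/
abbrev incl (x : FactorIndex M T) : Factor M T x →ₐ[ℚ] M.FactorProduct T :=
  LinearAlgebra.FreeProduct.ι ℚ (Factor M T) x

/-- The generator of the copy of `K_{m i j}` in the free product. -/
def fieldGen (i j : Fin N) (hij : i < j) (hm : 3 ≤ M i j) : M.FactorProduct T :=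
  incl M T (.field i j hij hm) (cosGen (M i j))

open Classical in
/-- The unit of the free product attached to the pair `i < j` with `3 ≤ m i j < ∞`: it is `1` for
an edge of `T` and the Laurent variable `z i j` otherwise. -/
def edgeUnit (i j : Fin N) (hij : i < j) (hm : 3 ≤ M i j) : (M.FactorProduct T)ˣ :=
  if hT : T.Adj i j then 1 else
    Units.map (incl M T (.laurent i j hij hm hT)).toMonoidHom (LaurentPolynomial.unitT ℚ)

open Classical in
/-- The coefficient `a i j` in the free product by which the edge from `i` to `j` acts: if `w` is
the unit attached to a pair `i < j` with `3 ≤ m i j < ∞` and `κ` generates the copy of `K_{m i j}`,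
then `a i j = w` and `a j i = w⁻¹ κ`; for `m i j = ∞` the `a i j` and `a j i` are the two free
variables. For pairs that are not edges the value is `0`. -/
def label (i j : Fin N) : M.FactorProduct T :=
  if hij : i < j then
    if hm : 3 ≤ M i j then (edgeUnit M T i j hij hm : M.FactorProduct T)
    else if h : M i j = 0 ∧ ¬ T.Adj i j then
      incl M T (.free i j hij h.1 h.2) (FreeAlgebra.ι ℚ (0 : Fin 2))
    else 0
  else if hji : j < i then
    if hm : 3 ≤ M j i then ((edgeUnit M T j i hji hm)⁻¹ : (M.FactorProduct T)ˣ) *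
      fieldGen M T j i hji hm
    else if h : M j i = 0 ∧ ¬ T.Adj j i then
      incl M T (.free j i hji h.1 h.2) (FreeAlgebra.ι ℚ (1 : Fin 2))
    else 0
  else 0

variable {M T}

section

variable {i j : Fin N} (hij : i < j)
include hij

lemma label_of_lt (hm : 3 ≤ M i j) : label M T i j = edgeUnit M T i j hij hm := by
  rw [label, dif_pos hij, dif_pos hm]

lemma label_of_gt (hm : 3 ≤ M i j) : label M T j i =
    ((edgeUnit M T i j hij hm)⁻¹ : (M.FactorProduct T)ˣ) * fieldGen M T i j hij hm := by
  rw [label, dif_neg hij.not_gt, dif_pos hij, dif_pos hm]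

lemma label_of_lt_of_eq_zero (hm : M i j = 0) (hT : ¬ T.Adj i j) :
    label M T i j = incl M T (.free i j hij hm hT) (FreeAlgebra.ι ℚ (0 : Fin 2)) := by
  rw [label, dif_pos hij, dif_neg (by lia), dif_pos ⟨hm, hT⟩]

lemma label_of_gt_of_eq_zero (hm : M i j = 0) (hT : ¬ T.Adj i j) :
    label M T j i = incl M T (.free i j hij hm hT) (FreeAlgebra.ι ℚ (1 : Fin 2)) := by
  rw [label, dif_neg hij.not_gt, dif_pos hij, dif_neg (by lia), dif_pos ⟨hm, hT⟩]

lemma label_of_adj (hm : 3 ≤ M i j) (hT : T.Adj i j) : label M T i j = 1 := by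
  rw [label_of_lt hij hm, edgeUnit, dif_pos hT, Units.val_one]

lemma label_of_not_adj (hm : 3 ≤ M i j) (hT : ¬ T.Adj i j) :
    label M T i j = incl M T (.laurent i j hij hm hT) (LaurentPolynomial.T 1) := by
  rw [label_of_lt hij hm, edgeUnit, dif_neg hT]
  rfl

lemma label_mul_label_of_lt (hm : 3 ≤ M i j) :
    label M T i j * label M T j i = fieldGen M T i j hij hm := by
  rw [label_of_lt hij hm, label_of_gt hij hm, Units.mul_inv_cancel_left]

end

lemma aeval_fieldGen {i j : Fin N} (hij : i < j) (hm : 3 ≤ M i j) :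
    aeval (fieldGen M T i j hij hm) ((cosPoly (M i j)).map (Int.castRingHom ℚ)) = 0 := by
  have h : aeval (incl M T (.field i j hij hm) (cosGen (M i j)))
      ((cosPoly (M i j)).map (Int.castRingHom ℚ)) = incl M T (.field i j hij hm)
        (aeval (cosGen (M i j)) ((cosPoly (M i j)).map (Int.castRingHom ℚ))) :=
    aeval_algHom_apply (incl M T (.field i j hij hm)) _ _
  rw [fieldGen, h, aeval_cosGen]
  exact map_zero (incl M T (.field i j hij hm))

/-- The labels satisfy the relations of the edges, in both orientations: for `j < i` the product
`a i j * a j i` is a conjugate of the generator of `K_{m i j}`. -/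
lemma aeval_label_mul_label {i j : Fin N} (hij : i ≠ j) (hm : 3 ≤ M i j) :
    aeval (label M T i j * label M T j i) ((cosPoly (M i j)).map (Int.castRingHom ℚ)) = 0 := by
  obtain h | h := lt_or_gt_of_ne hij
  · rw [label_mul_label_of_lt h hm, aeval_fieldGen]
  · rw [M.symmetric i j] at hm ⊢
    have h1 := mul_aeval_mul_comm ((cosPoly (M j i)).map (Int.castRingHom ℚ))
      (label M T j i) (label M T i j)
    rw [label_mul_label_of_lt h hm, aeval_fieldGen, zero_mul, label_of_lt h hm,
      Units.mul_right_eq_zero] at h1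
    rw [label_of_lt h hm, h1]

variable {B : Type*} [Ring B] [Algebra ℚ B]

/-- The free product is the universal algebra with elements `a i j`, one for each oriented edge,
that satisfy the relations of the edges, are units for `i < j` and `m i j < ∞`, and are equal to `1`
for `i < j` on the edges of `T`. -/
lemma exists_hom_label_eq (hfin : ∀ i j, T.Adj i j → 3 ≤ M i j) {t : Fin N → Fin N → B}
    (hK : ∀ {i j}, i < j → 3 ≤ M i j →
      aeval (t i j * t j i) ((cosPoly (M i j)).map (Int.castRingHom ℚ)) = 0)
    (hu : ∀ {i j}, i < j → 3 ≤ M i j → IsUnit (t i j))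
    (h1 : ∀ {i j}, i < j → T.Adj i j → t i j = 1) :
    ∃ g : M.FactorProduct T →ₐ[ℚ] B,
      ∀ {i j}, M.coxeterGraph.Adj i j → g (label M T i j) = t i j := by
  choose fK hfK using fun (i j : Fin N) (hij : i < j) (hm : 3 ≤ M i j) =>
    exists_cosField_hom (hK hij hm)
  choose fL hfL using fun (i j : Fin N) (hij : i < j) (hm : 3 ≤ M i j) =>
    LaurentPolynomial.exists_hom_of_unit (A := ℚ) (hu hij hm).unit
  let maps : ∀ x : FactorIndex M T, Factor M T x →ₐ[ℚ] B
    | .field i j hij hm => fK i j hij hm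
    | .laurent i j hij hm _ => fL i j hij hm
    | .free i j _ _ _ => FreeAlgebra.lift ℚ ![t i j, t j i]
  let g : M.FactorProduct T →ₐ[ℚ] B := LinearAlgebra.FreeProduct.lift ℚ (Factor M T) (maps _)
  have hg (x : FactorIndex M T) (a : Factor M T x) : g (incl M T x a) = maps x a :=
    DFunLike.congr_fun (LinearAlgebra.FreeProduct.lift_comp_ι ℚ (Factor M T) (maps _)) a
  have key {i j : Fin N} (hij : i < j) (h : 3 ≤ M i j ∨ M i j = 0) :
      g (label M T i j) = t i j ∧ g (label M T j i) = t j i := by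
    obtain hm | hm := h
    · have hw : g (label M T i j) = t i j := by
        by_cases hT : T.Adj i j
        · rw [label_of_adj hij hm hT, map_one, h1 hij hT]
        · rw [label_of_not_adj hij hm hT]
          exact (hg _ _).trans (hfL i j hij hm)
      refine ⟨hw, (hu hij hm).mul_left_cancel ?_⟩
      rw [← hw, ← map_mul, label_mul_label_of_lt hij hm, hw]
      exact (hg _ _).trans (hfK i j hij hm)
    · have hT : ¬ T.Adj i j := fun h => by have := hfin i j h; lia
      rw [label_of_lt_of_eq_zero hij hm hT, label_of_gt_of_eq_zero hij hm hT]
      exact ⟨(hg _ _).trans (FreeAlgebra.lift_ι_apply _ _),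
        (hg _ _).trans (FreeAlgebra.lift_ι_apply _ _)⟩
  refine ⟨g, fun {i j} hadj => ?_⟩
  obtain h | h := lt_or_gt_of_ne hadj.1
  · exact (key h hadj.2).1
  · exact (key h hadj.symm.2).2

/-- The labels of the oriented edges generate the free product. -/
lemma hom_ext_label {f g : M.FactorProduct T →ₐ[ℚ] B}
    (h : ∀ {i j}, M.coxeterGraph.Adj i j → f (label M T i j) = g (label M T i j)) : f = g := by
  have hadj {i j : Fin N} (hij : i < j) (hm : 3 ≤ M i j ∨ M i j = 0) :
      f (label M T i j) = g (label M T i j) ∧ f (label M T j i) = g (label M T j i) :=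
    have H : M.coxeterGraph.Adj i j := ⟨hij.ne, hm⟩
    ⟨h H, h H.symm⟩
  refine (LinearAlgebra.FreeProduct.lift ℚ (Factor M T)).symm.injective ?_
  change (fun {x} => f.comp (incl M T x)) = fun {x} => g.comp (incl M T x)
  funext x
  match x with
  | .field i j hij hm =>
    obtain ⟨h1, h2⟩ := hadj hij (.inl hm)
    refine cosField_hom_ext ?_
    change f (fieldGen M T i j hij hm) = g (fieldGen M T i j hij hm)
    rw [← label_mul_label_of_lt hij hm, map_mul, map_mul, h1, h2]
  | .laurent i j hij hm hT =>
    refine LaurentPolynomial.algHom_ext_T ?_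
    have h1 := (hadj hij (.inl hm)).1
    rw [label_of_not_adj hij hm hT] at h1
    exact h1
  | .free i j hij hm hT =>
    obtain ⟨h1, h2⟩ := hadj hij (.inr hm)
    rw [label_of_lt_of_eq_zero hij hm hT] at h1
    rw [label_of_gt_of_eq_zero hij hm hT] at h2
    refine FreeAlgebra.hom_ext ?_
    funext x
    fin_cases x
    · exact h1
    · exact h2

end

end CoxeterMatrix

/-! ### The quotient of the path algebra of a Coxeter graph -/

namespace CoxeterMatrix

open Polynomial PathAlgebra

section

variable {V : Type*} [Fintype V] [DecidableEq V] (M : CoxeterMatrix V)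

/-- The image of the vertex `i` in the quotient of the path algebra. -/
noncomputable def vtx (i : V) : M.PathQuotient :=
  (relationIdeal M).ringCon.mkₐ ℚ (vertex ℚ M.coxeterGraph i)

/-- The image in the quotient of the path algebra of the edge from `i` to `j`, and `0` if there is
no such edge. -/
noncomputable def arrow (i j : V) : M.PathQuotient :=
  (relationIdeal M).ringCon.mkₐ ℚ (edgeOrZero ℚ M.coxeterGraph i j)

lemma isRep_vtx_arrow : IsRep M.coxeterGraph (vtx M) (arrow M) :=
  (isRep_vertex_edge ℚ M.coxeterGraph).map ((relationIdeal M).ringCon.mkₐ ℚ)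

variable {M}

lemma map_evalEdge {B : Type*} [Semiring B] [Algebra ℚ B]
    (f : PathAlgebra ℚ M.coxeterGraph →ₐ[ℚ] B) (p : ℚ[X]) {i j : V} (h : M.coxeterGraph.Adj i j) :
    f (evalEdge p h) = f (vertex ℚ M.coxeterGraph i) *
      aeval (f (edgeOrZero ℚ M.coxeterGraph i j) * f (edgeOrZero ℚ M.coxeterGraph j i)) p := by
  rw [evalEdge, map_mul, edgeOrZero_of_adj h, edgeOrZero_of_adj h.symm, ← map_mul, ← map_mul,
    aeval_algHom_apply, map_mul]

lemma vtx_mul_aeval_arrow {i j : V} (h : M.coxeterGraph.Adj i j) (hm : 3 ≤ M i j) :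
    vtx M i * aeval (arrow M i j * arrow M j i) ((cosPoly (M i j)).map (Int.castRingHom ℚ)) = 0 := by
  have := map_evalEdge ((relationIdeal M).ringCon.mkₐ ℚ)
    ((cosPoly (M i j)).map (Int.castRingHom ℚ)) h
  refine this.symm.trans ?_
  have hmem : evalEdge ((cosPoly (M i j)).map (Int.castRingHom ℚ)) h ∈ relationIdeal M :=
    TwoSidedIdeal.subset_span ⟨i, j, h, hm, rfl⟩
  exact (RingCon.eq _).2 ((TwoSidedIdeal.mem_iff _ _).1 hmem)

lemma exists_pathQuotient_hom {B : Type*} [Ring B] [Algebra ℚ B] {e : V → B} {y : V → V → B}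
    (H : IsRep M.coxeterGraph e y)
    (hy : ∀ {i j}, M.coxeterGraph.Adj i j → 3 ≤ M i j →
      e i * aeval (y i j * y j i) ((cosPoly (M i j)).map (Int.castRingHom ℚ)) = 0) :
    ∃ f : M.PathQuotient →ₐ[ℚ] B, (∀ i, f (vtx M i) = e i) ∧
      ∀ {i j}, M.coxeterGraph.Adj i j → f (arrow M i j) = y i j := by
  have hle : relationIdeal M ≤ TwoSidedIdeal.ker (lift (A := ℚ) H) := by
    refine TwoSidedIdeal.span_le.2 ?_
    rintro _ ⟨i, j, h, hm, rfl⟩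
    rw [SetLike.mem_coe, TwoSidedIdeal.mem_ker, map_evalEdge, edgeOrZero_of_adj h,
      edgeOrZero_of_adj h.symm, lift_vertex, lift_edge, lift_edge, hy h hm]
  refine ⟨(relationIdeal M).ringCon.liftₐ (lift (A := ℚ) H) (TwoSidedIdeal.ringCon_le_iff.1 hle),
    fun i => ?_, fun {i j} h => ?_⟩
  · exact lift_vertex H i
  · exact (congrArg (lift (A := ℚ) H) (edgeOrZero_of_adj h)).trans (lift_edge H h)

lemma pathQuotient_hom_ext {B : Type*} [Ring B] [Algebra ℚ B] {f g : M.PathQuotient →ₐ[ℚ] B}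
    (hv : ∀ i, f (vtx M i) = g (vtx M i))
    (he : ∀ {i j}, M.coxeterGraph.Adj i j → f (arrow M i j) = g (arrow M i j)) : f = g := by
  refine RingCon.Quotient.hom_extₐ (algHom_ext hv fun {i j} h => ?_)
  have := he h
  rw [arrow, edgeOrZero_of_adj h] at this
  exact this

variable (M) in
/-- Edges with a finite label are invertible in the quotient of the path algebra. -/
lemma exists_inverse_arrow (i j : V) : ∃ z : M.PathQuotient,
    M.coxeterGraph.Adj i j → 3 ≤ M i j → vtx M j * z = z ∧ z * vtx M i = z ∧
      arrow M i j * z = vtx M i ∧ z * arrow M i j = vtx M j := by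
  by_cases h : M.coxeterGraph.Adj i j ∧ 3 ≤ M i j
  · obtain ⟨h, hm⟩ := h
    have H := isRep_vtx_arrow M
    have h6 := vtx_mul_aeval_arrow h.symm (M.symmetric i j ▸ hm)
    rw [M.symmetric j i] at h6
    obtain ⟨z, hz⟩ := exists_inverse_in_corner (coeff_zero_map_cosPoly_ne_zero hm)
      (H.left h) (H.left h.symm) (H.right h.symm) (vtx_mul_aeval_arrow h hm) h6
    exact ⟨z, fun _ _ => hz⟩
  · exact ⟨0, fun h1 h2 => absurd ⟨h1, h2⟩ h⟩

end

/-! ### The homomorphism to the matrix algebra -/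

section ToMatrix

variable {n : Type*} [Fintype n] [DecidableEq n] {Q : Type*} [Ring Q]

lemma isRep_single (G : SimpleGraph n) (a : n → n → Q) :
    IsRep G (fun i => Matrix.single i i (1 : Q)) (fun i j => Matrix.single i j (a i j)) where
  mul i j := by
    split_ifs with h
    · subst h; simp
    · simp [h]
  sum := by
    rw [← Matrix.diagonal_one, ← Matrix.sum_single_eq_diagonal]
  left _ := by simp
  right _ := by simp

lemma walkProd_single {G : SimpleGraph n} {y : n → n → Matrix n n Q}
    (hy : ∀ {i j}, G.Adj i j → y i j = Matrix.single i j 1) {i j : n} (p : G.Walk i j) :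
    walkProd (fun i => Matrix.single i i (1 : Q)) y p = Matrix.single i j 1 := by
  induction p with
  | nil => rfl
  | cons h p ih => rw [walkProd_cons, ih, hy h]; simp

lemma single_one_mul_aeval_single [Algebra ℚ Q] (i : n) (a : Q) (p : ℚ[X]) :
    Matrix.single i i 1 * aeval (Matrix.single i i a) p = Matrix.single i i (aeval a p) := by
  have h (a : Q) : Matrix.single i i 1 * Matrix.single i i a =
      Matrix.scalarAlgHom n ℚ a * Matrix.single i i 1 := by
    ext k l
    simp [Matrix.single_apply]
  have h' : SemiconjBy (Matrix.single i i 1) (Matrix.single i i a) (Matrix.scalarAlgHom n ℚ a) :=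
    h a
  rw [(h'.aeval_right p).eq, aeval_algHom_apply, ← h]
  simp

end ToMatrix

end CoxeterMatrix

/-! ### The isomorphism -/

namespace CoxeterMatrix

open Polynomial PathAlgebra IsMatrixUnits

/-- Orient each edge of the spanning tree `T` from its smaller to its larger end point. The
quotient of the path algebra contains matrix units whose entry at `(i, j)` is the edge itself if
`(i, j)` is an edge of `T` with `i < j`. They are products along walks in `T` of elements `y i j`
that are defined in terms of the edges by a two-sided inverse. -/
lemma exists_matrixUnits {V : Type*} [Fintype V] [LinearOrder V] (M : CoxeterMatrix V)
    {T : SimpleGraph V} (hT : T.IsTree)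
    (hTG : T ≤ M.coxeterGraph) (hfin : ∀ i j, T.Adj i j → 3 ≤ M i j) :
    ∃ (y : V → V → M.PathQuotient) (w : ∀ i j, T.Walk i j),
      (∀ {i j}, T.Adj i j → i < j → y i j = arrow M i j) ∧
      (∀ {i j}, T.Adj i j → j < i → y i j * vtx M j = y i j ∧ y i j * arrow M j i = vtx M i) ∧
      IsMatrixUnits (fun i j => walkProd (vtx M) y (w i j)) ∧
      (∀ i, walkProd (vtx M) y (w i i) = vtx M i) ∧
      ∀ {i j}, T.Adj i j → walkProd (vtx M) y (w i j) = y i j := by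
  choose z hz using exists_inverse_arrow M
  have hz' {i j : V} (h : T.Adj i j) := hz i j (hTG h) (hfin i j h)
  have HM := isRep_vtx_arrow M
  set y : V → V → M.PathQuotient := fun i j => if i < j then arrow M i j else z j i with hy
  have hlt {i j : V} (h : i < j) : y i j = arrow M i j := if_pos h
  have hgt {i j : V} (h : j < i) : y i j = z j i := if_neg h.not_gt
  have H : IsRep T (vtx M) y := by
    refine ⟨HM.mul, HM.sum, fun {i j} h => ?_, fun {i j} h => ?_⟩ <;>
      obtain h' | h' := lt_or_gt_of_ne h.ne
    · rw [hlt h', HM.left (hTG h)]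
    · rw [hgt h', (hz' h.symm).1]
    · rw [hlt h', HM.right (hTG h)]
    · rw [hgt h', (hz' h.symm).2.1]
  have hinv {i j : V} (h : T.Adj i j) : y i j * y j i = vtx M i := by
    obtain h' | h' := lt_or_gt_of_ne h.ne
    · rw [hlt h', hgt h', (hz' h).2.2.1]
    · rw [hgt h', hlt h', (hz' h.symm).2.2.2]
  let w (i j : V) : T.Walk i j := (hT.connected.preconnected i j).some
  refine ⟨y, w, fun _ h => hlt h, fun {i j} h h' => ?_, H.isMatrixUnits hT hinv w,
    fun i => H.walkProd_eq hT.isAcyclic hinv (w i i) .nil, fun {i j} h => ?_⟩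
  · rw [hgt h']
    exact ⟨(hz' h.symm).2.1, (hz' h.symm).2.2.2⟩
  · rw [H.walkProd_eq hT.isAcyclic hinv (w i j) (.cons h .nil), walkProd_cons, walkProd_nil,
      H.right h]

/-- Spreading the edges with respect to a system of matrix units on the vertices. If a tree edge
`(i, j)`, `i < j`, is itself a matrix unit, the spread edges satisfy the relations of the labels. -/
lemma exists_hom_spread {N : ℕ} {M : CoxeterMatrix (Fin N)} {T : SimpleGraph (Fin N)}
    (hfin : ∀ i j, T.Adj i j → 3 ≤ M i j) {F : Fin N → Fin N → M.PathQuotient}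
    (HF : IsMatrixUnits F) (hF : ∀ i, F i i = vtx M i)
    (hFT : ∀ {i j}, T.Adj i j → i < j → F i j = arrow M i j) :
    ∃ g : M.FactorProduct T →ₐ[ℚ] commutant ℚ F,
      ∀ {i j}, M.coxeterGraph.Adj i j → g (label M T i j) = HF.spread ℚ i j (arrow M i j) := by
  have HM := isRep_vtx_arrow M
  refine exists_hom_label_eq hfin (t := fun i j => HF.spread ℚ i j (arrow M i j))
    (fun {i j} hij hm => ?_) (fun {i j} hij hm => ?_) (fun {i j} hij h => ?_)
  · have hadj : M.coxeterGraph.Adj i j := ⟨hij.ne, .inl hm⟩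
    refine HF.commutant_eq_zero (i := i) ?_
    rw [HF.spread_mul_spread _ _ _ (by rw [hF, HM.right hadj])]
    set b := arrow M i j * arrow M j i with hb
    have h1 : F i i * b = b := by rw [hF, hb, ← mul_assoc, HM.left hadj]
    have h2 : b * F i i = b := by rw [hF, hb, mul_assoc, HM.right hadj.symm]
    have h3 : SemiconjBy (F i i) b (HF.spread ℚ i i b : M.PathQuotient) :=
      h1.trans (HF.coe_spread_mul i i h1 h2).symm
    have h4 := vtx_mul_aeval_arrow hadj hm
    rw [← hF, ← hb, (h3.aeval_right _).eq] at h4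
    rw [← h4]
    congr 1
    exact (aeval_algHom_apply (commutant ℚ F).val _ _).symm
  · have hadj : M.coxeterGraph.Adj i j := ⟨hij.ne, .inl hm⟩
    obtain ⟨z, hz⟩ := exists_inverse_arrow M i j
    obtain ⟨-, hz2, hz3, hz4⟩ := hz hadj hm
    refine ⟨⟨HF.spread ℚ i j (arrow M i j), HF.spread ℚ j i z, ?_, ?_⟩, rfl⟩
    · rw [HF.spread_mul_spread _ _ _ (by rw [hF, HM.right hadj]), hz3, ← hF, HF.spread_self]
    · rw [HF.spread_mul_spread _ _ _ (by rw [hF, hz2]), hz4, ← hF, HF.spread_self]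
  · rw [← hFT h hij, HF.spread_self]

/-- The homomorphism to the matrix algebra that sends the edge from `i` to `j` to `a i j E i j`,
where `a i j` is its label. -/
lemma exists_hom_to_matrix {N : ℕ} (M : CoxeterMatrix (Fin N)) (T : SimpleGraph (Fin N)) :
    ∃ f : M.PathQuotient →ₐ[ℚ] Matrix (Fin N) (Fin N) (M.FactorProduct T),
      (∀ i, f (vtx M i) = Matrix.single i i 1) ∧
      ∀ {i j}, M.coxeterGraph.Adj i j → f (arrow M i j) = Matrix.single i j (label M T i j) := by
  refine exists_pathQuotient_hom (isRep_single M.coxeterGraph (label M T)) fun {i j} h hm => ?_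
  rw [Matrix.single_mul_single_same, single_one_mul_aeval_single, aeval_label_mul_label h.ne hm,
    Matrix.single_zero]

end CoxeterMatrix

open CoxeterMatrix PathAlgebra IsMatrixUnits in
theorem mainTheorem2 {N : ℕ} (M : CoxeterMatrix (Fin N)) {W : Type*} [Group W]
    (_cs : CoxeterSystem M W) (T : SimpleGraph (Fin N)) (hT : T.IsTree)
    (hTG : T ≤ M.coxeterGraph) (hfin : ∀ i j, T.Adj i j → 3 ≤ M i j) :
    Nonempty (M.PathQuotient ≃ₐ[ℚ] Matrix (Fin N) (Fin N) (M.FactorProduct T)) := by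
  have HM := isRep_vtx_arrow M
  obtain ⟨y, w, hlt, hgt, HF, hFv, hFT⟩ := exists_matrixUnits M hT hTG hfin
  set F : Fin N → Fin N → M.PathQuotient := fun i j => walkProd (vtx M) y (w i j) with hF
  have hFv : ∀ i, F i i = vtx M i := hFv
  obtain ⟨g, hg⟩ := exists_hom_spread hfin HF hFv fun h h' => (hFT h).trans (hlt h h')
  obtain ⟨f, hfv, hfa⟩ := exists_hom_to_matrix M T
  -- The homomorphism `f` maps the matrix units `F` to the standard ones,
  have hfF (i j : Fin N) : f (F i j) = Matrix.single i j 1 := by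
    rw [hF, map_walkProd]
    simp only [hfv]
    refine walkProd_single (fun {i j} h => ?_) (w i j)
    obtain h' | h' := lt_or_gt_of_ne h.ne
    · rw [hlt h h', hfa (hTG h), label_of_adj h' (hfin i j h) h]
    · obtain ⟨h1, h2⟩ := hgt h h'
      have h3 : f (arrow M j i) = Matrix.single j i 1 := by
        rw [hfa (hTG h.symm), label_of_adj h' (hfin j i h.symm) h.symm]
      calc f (y i j) = f (y i j) * Matrix.single j j 1 := by rw [← hfv, ← map_mul, h1]
        _ = f (y i j) * (f (arrow M j i) * Matrix.single i j 1) := by rw [h3]; simp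
        _ = Matrix.single i j 1 := by rw [← mul_assoc, ← map_mul, h2, hfv]; simp
  -- and it is inverse to `g` up to the embedding of the free product as scalar matrices.
  have hfg (q : M.FactorProduct T) :
      f (g q : M.PathQuotient) = Matrix.scalarAlgHom (Fin N) ℚ q := by
    have : (f.comp (commutant ℚ F).val).comp g = Matrix.scalarAlgHom (Fin N) ℚ := by
      refine hom_ext_label fun {i j} h => ?_
      change f (g (label M T i j) : M.PathQuotient) = _
      rw [hg h, HF.coe_spread, map_sum]
      simp only [map_mul, hfF, hfa h]
      simp [Matrix.sum_single_eq_diagonal, Matrix.scalar_apply]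
    exact DFunLike.congr_fun this q
  refine ⟨AlgEquiv.ofAlgHom f (HF.matrixLift g) ?_ ?_⟩
  · ext1 X
    rw [AlgHom.comp_apply, HF.matrixLift_apply, AlgHom.id_apply]
    conv_rhs => rw [Matrix.matrix_eq_sum_single X]
    simp only [map_sum, map_mul, hfg, hfF]
    refine Finset.sum_congr rfl fun i _ => Finset.sum_congr rfl fun j _ => ?_
    ext k l
    simp +contextual [Matrix.scalar_apply, Matrix.single_apply]
  · refine pathQuotient_hom_ext (fun i => ?_) fun {i j} h => ?_
    · rw [AlgHom.comp_apply, hfv, HF.matrixLift_single, map_one, OneMemClass.coe_one, one_mul]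
      exact hFv i
    · rw [AlgHom.comp_apply, hfa h, HF.matrixLift_single, hg h]
      exact HF.coe_spread_mul i j (by rw [hFv, HM.left h]) (by rw [hFv, HM.right h])
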